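/- Let $(X,\omega)$ be a Hermitian manifold, i.e. a complex manifold $X$ of dimension $n$ with a smooth Hermitian metric $g$ on $T^{1,0}X$, with components $g_{i\bar j}$ in holomorphic coordinates, and $\omega=\sqrt{-1}\sum_{i,j} g_{i\bar j}\,dz^i\wedge d\bar z^j$ (no compactness is assumed). Let ${}^c\nabla$ be the Chern connection on $T^{1,0}X$ and let ${}^l\nabla$ be the Lichnerowicz connection, that is, the connection on $T^{1,0}X$ obtained by restricting the complexified Levi-Civita connection to $T^{1,0}X$ and projecting back to $T^{1,0}X$. For $t\in\mathbb{R}$ let ${}^t\nabla:=t\,{}^c\nabla+(1-t)\,{}^l\nabla$ be the $t$-Gauduchon connection, ${}^tR$ its curvature tensor, and $$ {}^t\mathrm{HSC}_\omega(v):=\frac{1}{|v|_\omega^4}\,{}^tR(v,\bar v,v,\bar v),\qquad 0\neq v\in T^{1,0}X, $$ its holomorphic sectional curvature. Theorem. Let $t,s\in\mathbb{R}$. If ${}^t\mathrm{HSC}_\omega(v)={}^s\mathrm{HSC}_\omega(v)$ for every nonzero $v\in T^{1,0}X$, then $t=s$, or $t=2-s$, or $\omega$ is Kähler (that is, $d\omega=0$).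 -/

import Mathlib

open scoped Manifold ContDiff ComplexConjugate

noncomputable section

namespace HermitianGeometry

/-- The model space `ℂⁿ`. -/
abbrev Cn (n : ℕ) : Type := EuclideanSpace ℂ (Fin n)

/-! ### Calculus in holomorphic coordinates on `ℂⁿ`

The complexified tangent bundle has the coordinate frame `∂/∂zⁱ`, `∂/∂z̄ⁱ`. It is indexed by
`Fin n ⊕ Fin n`: the index `Sum.inl i` stands for `∂/∂zⁱ` and `Sum.inr i` for `∂/∂z̄ⁱ`. -/

/-- The `i`-th vector of the standard basis of `ℂⁿ`. -/
def stdVec {n : ℕ} (i : Fin n) : Cn n := EuclideanSpace.single i 1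

/-- The Wirtinger derivatives `∂f/∂zⁱ` (index `inl i`) and `∂f/∂z̄ⁱ` (index `inr i`). -/
def wirtinger {n : ℕ} (a : Fin n ⊕ Fin n) (f : Cn n → ℂ) (z : Cn n) : ℂ :=
  match a with
  | Sum.inl i =>
      (fderiv ℝ f z (stdVec i) - Complex.I * fderiv ℝ f z (Complex.I • stdVec i)) / 2
  | Sum.inr i =>
      (fderiv ℝ f z (stdVec i) + Complex.I * fderiv ℝ f z (Complex.I • stdVec i)) / 2

/-- The matrix, in the frame `∂/∂zⁱ, ∂/∂z̄ⁱ`, of the complex-bilinear extension of the metric with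
coefficients `g i j = g(∂/∂zⁱ, ∂/∂z̄ʲ)`; the pairings `(∂/∂zⁱ, ∂/∂zʲ)` and `(∂/∂z̄ⁱ, ∂/∂z̄ʲ)` vanish. -/
def complexifiedMetric {n : ℕ} (g : Cn n → Matrix (Fin n) (Fin n) ℂ) (z : Cn n) :
    Matrix (Fin n ⊕ Fin n) (Fin n ⊕ Fin n) ℂ :=
  Matrix.fromBlocks 0 (g z) (g z).transpose 0

/-- Christoffel symbols `Γ_{ab}^c` of the complex-linear extension of the Levi-Civita connection in
the (commuting) frame `∂/∂zⁱ, ∂/∂z̄ⁱ`: `Γ_{ab}^c = ½ G^{cd} (∂_a G_{bd} + ∂_b G_{ad} - ∂_d G_{ab})`. -/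
def leviCivitaSymbol {n : ℕ} (g : Cn n → Matrix (Fin n) (Fin n) ℂ) (z : Cn n)
    (a b c : Fin n ⊕ Fin n) : ℂ :=
  (1 / 2) * ∑ d, (complexifiedMetric g z)⁻¹ c d *
    (wirtinger a (fun w => complexifiedMetric g w b d) z
      + wirtinger b (fun w => complexifiedMetric g w a d) z
      - wirtinger d (fun w => complexifiedMetric g w a b) z)

/-- Coefficients, `∇_a (∂/∂zʲ) = ∑ₖ Γ_{aj}^k ∂/∂zᵏ`, of the Lichnerowicz connection on `T^{1,0}`:
the complexified Levi-Civita connection restricted to `T^{1,0}` and projected back onto it. -/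
def lichnerowiczSymbol {n : ℕ} (g : Cn n → Matrix (Fin n) (Fin n) ℂ) (z : Cn n)
    (a : Fin n ⊕ Fin n) (j k : Fin n) : ℂ :=
  leviCivitaSymbol g z a (Sum.inl j) (Sum.inl k)

/-- Coefficients of the Chern connection on `T^{1,0}`. The `(0,1)`-part is `∂̄`, so it annihilates
the holomorphic frame `∂/∂zʲ`, and then metric compatibility reads
`∂ᵢ g_{j l̄} = ∑ₖ Γ_{ij}^k g_{k l̄}`, that is `Γ_{ij}^k = ∑ₗ (∂ᵢ g_{j l̄}) g^{l̄ k}`. -/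
def chernSymbol {n : ℕ} (g : Cn n → Matrix (Fin n) (Fin n) ℂ) (z : Cn n)
    (a : Fin n ⊕ Fin n) (j k : Fin n) : ℂ :=
  match a with
  | Sum.inl i => ∑ l, wirtinger (Sum.inl i) (fun w => g w j l) z * (g z)⁻¹ l k
  | Sum.inr _ => 0

/-- Coefficients of the `t`-Gauduchon connection `t • (Chern) + (1 - t) • (Lichnerowicz)`. -/
def gauduchonSymbol {n : ℕ} (g : Cn n → Matrix (Fin n) (Fin n) ℂ) (t : ℝ) (z : Cn n)
    (a : Fin n ⊕ Fin n) (j k : Fin n) : ℂ :=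
  (t : ℂ) * chernSymbol g z a j k + (1 - (t : ℂ)) * lichnerowiczSymbol g z a j k

/-- Curvature of a connection `∇_a (∂/∂zᵏ) = ∑ₚ Γ_{ak}^p ∂/∂zᵖ` on `T^{1,0}`: the coefficient of
`∂/∂zᵖ` in `∇_a ∇_b (∂/∂zᵏ) - ∇_b ∇_a (∂/∂zᵏ)`. -/
def curvatureCoeff {n : ℕ} (Γ : Cn n → Fin n ⊕ Fin n → Fin n → Fin n → ℂ) (z : Cn n)
    (a b : Fin n ⊕ Fin n) (k p : Fin n) : ℂ :=
  wirtinger a (fun w => Γ w b k p) z - wirtinger b (fun w => Γ w a k p) z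
    + ∑ q, (Γ z b k q * Γ z a q p - Γ z a k q * Γ z b q p)

/-- The components `R_{i j̄ k l̄} = g(R(∂ᵢ, ∂_j̄) ∂ₖ, ∂_l̄)` of the `t`-Gauduchon curvature. -/
def gauduchonCurvature {n : ℕ} (g : Cn n → Matrix (Fin n) (Fin n) ℂ) (t : ℝ) (z : Cn n)
    (i j k l : Fin n) : ℂ :=
  ∑ p, curvatureCoeff (gauduchonSymbol g t) z (Sum.inl i) (Sum.inr j) k p * g z p l

/-- The real-linear coordinate form `dzⁱ`. -/
def dz {n : ℕ} (i : Fin n) : Cn n →L[ℝ] ℂ :=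
  (EuclideanSpace.proj i : Cn n →L[ℂ] ℂ).restrictScalars ℝ

/-- The real-linear coordinate form `dz̄ⁱ`. -/
def dzbar {n : ℕ} (i : Fin n) : Cn n →L[ℝ] ℂ :=
  (Complex.conjCLE : ℂ →L[ℝ] ℂ).comp (dz i)

/-- The wedge product `α ∧ β` of complex-valued `1`-forms,
`(α ∧ β)(u, v) = α(u) β(v) - α(v) β(u)`. -/
def wedge {n : ℕ} (α β : Cn n →L[ℝ] ℂ) : Cn n [⋀^Fin 2]→L[ℝ] ℂ :=
  ContinuousMultilinearMap.alternatization
    ((ContinuousMultilinearMap.mkPiAlgebraFin ℝ 2 ℂ).compContinuousLinearMap ![α, β])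

/-- The form `ω = √-1 ∑ g_{i j̄} dzⁱ ∧ dz̄ʲ` in coordinates. -/
def fundamentalForm {n : ℕ} (g : Cn n → Matrix (Fin n) (Fin n) ℂ) (z : Cn n) :
    Cn n [⋀^Fin 2]→L[ℝ] ℂ :=
  ∑ i, ∑ j, (Complex.I * g z i j) • wedge (dz i) (dzbar j)

/-! ### Hermitian manifolds

A complex manifold of dimension `n` is a manifold `M` modelled on `ℂⁿ` with holomorphic (complex
analytic) transition functions. Its holomorphic tangent bundle `T^{1,0} M` is the complex tangent
bundle `TangentSpace 𝓘(ℂ, Cn n)`. -/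

/-- Holomorphic coordinate vector field `∂/∂zⁱ` of the chart `φ`, at the point with
coordinates `z`. -/
def coordVec {n : ℕ} {M : Type*} [TopologicalSpace M] [ChartedSpace (Cn n) M]
    (φ : OpenPartialHomeomorph M (Cn n)) (z : Cn n) (i : Fin n) :
    TangentSpace 𝓘(ℂ, Cn n) (φ.symm z) :=
  mfderiv 𝓘(ℂ, Cn n) 𝓘(ℂ, Cn n) φ.symm z (stdVec i)

/-- A (smooth) Hermitian metric on a complex manifold: positive definite Hermitian forms
`h_x(v, w) = g(v, w̄)` on the holomorphic tangent spaces, complex linear in the first and conjugate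
linear in the second variable, with coefficients that are smooth, in the real sense, in each
holomorphic chart. -/
structure HermitianMetric (n : ℕ) (M : Type*) [TopologicalSpace M] [ChartedSpace (Cn n) M]
    [IsManifold 𝓘(ℂ, Cn n) ω M] where
  form : ∀ x : M, TangentSpace 𝓘(ℂ, Cn n) x →ₗ[ℂ] TangentSpace 𝓘(ℂ, Cn n) x →ₗ⋆[ℂ] ℂ
  conj_symm : ∀ (x : M) (v w : TangentSpace 𝓘(ℂ, Cn n) x), conj (form x v w) = form x w v
  pos_def : ∀ (x : M) (v : TangentSpace 𝓘(ℂ, Cn n) x), v ≠ 0 → 0 < (form x v v).re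
  smooth : ∀ φ ∈ atlas (Cn n) M, ∀ i j : Fin n,
    ContDiffOn ℝ ∞ (fun z => form (φ.symm z) (coordVec φ z i) (coordVec φ z j)) φ.target

namespace HermitianMetric

variable {n : ℕ} {M : Type*} [TopologicalSpace M] [ChartedSpace (Cn n) M]
  [IsManifold 𝓘(ℂ, Cn n) ω M]

/-- The coefficients `g_{i j̄} = h(∂/∂zⁱ, ∂/∂zʲ)` of the metric in the chart `φ`. -/
def coeff (h : HermitianMetric n M) (φ : OpenPartialHomeomorph M (Cn n)) (z : Cn n) :
    Matrix (Fin n) (Fin n) ℂ :=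
  Matrix.of fun i j => h.form (φ.symm z) (coordVec φ z i) (coordVec φ z j)

/-- The components `vⁱ` of a tangent vector `v = ∑ vⁱ ∂/∂zⁱ` at `x` in the chart at `x`. -/
def components (x : M) (v : TangentSpace 𝓘(ℂ, Cn n) x) : Cn n :=
  mfderiv 𝓘(ℂ, Cn n) 𝓘(ℂ, Cn n) (chartAt (Cn n) x) x v

/-- The `(1,1)`-part `ᵗR(u, v̄, w, ȳ)` of the `t`-Gauduchon curvature tensor at `x`, computed in
the preferred chart at `x`. -/
def gauduchonR (h : HermitianMetric n M) (t : ℝ) (x : M)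
    (u v w y : TangentSpace 𝓘(ℂ, Cn n) x) : ℂ :=
  ∑ i, ∑ j, ∑ k, ∑ l,
    gauduchonCurvature (h.coeff (chartAt (Cn n) x)) t (chartAt (Cn n) x x) i j k l
      * components x u i * conj (components x v j) * components x w k * conj (components x y l)

/-- The `t`-Gauduchon holomorphic sectional curvature `ᵗR(v, v̄, v, v̄) / |v|⁴` in the direction of a
nonzero `(1,0)`-tangent vector `v`; the numerator is a real number. -/
def gauduchonHSC (h : HermitianMetric n M) (t : ℝ) (x : M) (v : TangentSpace 𝓘(ℂ, Cn n) x) : ℝ :=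
  (h.gauduchonR t x v v v v).re / (h.form x v v).re ^ 2

/-- The metric is Kähler: `dω = 0` at every point `x`, where the exterior derivative of the
fundamental form is computed in the preferred chart at `x`. -/
def IsKahler (h : HermitianMetric n M) : Prop :=
  ∀ x : M, extDeriv (fundamentalForm (h.coeff (chartAt (Cn n) x))) (chartAt (Cn n) x x) = 0

end HermitianMetric

end HermitianGeometry

end

/-! The curvature depends on `t` through one square. Let `T` be the Chern torsion with its last
index lowered, and `T_v` the covector `q ↦ T(v, q, v̄)`. Then `ᵗR(v, v̄, v, v̄) = ¹R(v, v̄, v, v̄) -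
((1 - t) / 2)² |T_v|²`, with the norm taken by the inverse metric (`sum_gauduchonCurvature`).
Equality of the curvatures for `t` and `s` thus forces either `(1 - t)² = (1 - s)²`, that is `t = s`
or `t = 2 - s`, or `T_v = 0` for every `v`. In the second case polarisation over `ℂ` gives `T = 0`
(`torsion_eq_zero_of_re_gauduchonCurvature_eq`), and vanishing torsion means `dω = 0`
(`extDeriv_fundamentalForm_eq_zero`). The argument is pointwise in a chart, so no compactness
enters. -/

namespace HermitianGeometry

/-! ### Wirtinger calculus. -/

section Wirtinger

variable {n : ℕ} {f f₁ f₂ : Cn n → ℂ} {z : Cn n}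

theorem wirtinger_congr (a : Fin n ⊕ Fin n) (hf : f₁ =ᶠ[nhds z] f₂) :
    wirtinger a f₁ z = wirtinger a f₂ z := by
  cases a <;> simp only [wirtinger, hf.fderiv_eq]

theorem wirtinger_const (a : Fin n ⊕ Fin n) (c : ℂ) : wirtinger a (fun _ => c) z = 0 := by
  cases a <;> simp [wirtinger]

theorem wirtinger_mul (a : Fin n ⊕ Fin n) (h₁ : DifferentiableAt ℝ f₁ z)
    (h₂ : DifferentiableAt ℝ f₂ z) :
    wirtinger a (fun w => f₁ w * f₂ w) z
      = wirtinger a f₁ z * f₂ z + f₁ z * wirtinger a f₂ z := by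
  cases a <;> simp only [wirtinger, fderiv_fun_mul h₁ h₂] <;>
    simp <;> ring

theorem wirtinger_sum {ι : Type*} (u : Finset ι) {F : ι → Cn n → ℂ} (a : Fin n ⊕ Fin n)
    (hF : ∀ i ∈ u, DifferentiableAt ℝ (F i) z) :
    wirtinger a (fun w => ∑ i ∈ u, F i w) z = ∑ i ∈ u, wirtinger a (F i) z := by
  cases a <;> simp only [wirtinger, fderiv_fun_sum hF] <;>
    simp [← Finset.sum_div, Finset.mul_sum, Finset.sum_add_distrib, Finset.sum_sub_distrib]

theorem wirtinger_const_mul (a : Fin n ⊕ Fin n) (c : ℂ) (hf : DifferentiableAt ℝ f z) :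
    wirtinger a (fun w => c * f w) z = c * wirtinger a f z := by
  rw [wirtinger_mul a (differentiableAt_const c) hf, wirtinger_const, zero_mul, zero_add]

theorem wirtinger_inr_conj (i : Fin n) (hf : DifferentiableAt ℝ f z) :
    wirtinger (Sum.inr i) (fun w => conj (f w)) z = conj (wirtinger (Sum.inl i) f z) := by
  have h : fderiv ℝ (fun w => conj (f w)) z = (Complex.conjCLE : ℂ →L[ℝ] ℂ).comp (fderiv ℝ f z) :=
    (Complex.conjCLE.hasFDerivAt.comp z hf.hasFDerivAt).fderiv
  simp only [wirtinger, h]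
  simp [map_ofNat]

theorem fderiv_eq_sum_wirtinger (f : Cn n → ℂ) (z u : Cn n) :
    fderiv ℝ f z u
      = ∑ k, (wirtinger (Sum.inl k) f z * u k + wirtinger (Sum.inr k) f z * conj (u k)) := by
  have hu : u = ∑ k, ((u k).re • (stdVec k : Cn n) + (u k).im • (Complex.I • stdVec k : Cn n)) := by
    ext j
    simp [stdVec, Pi.single_apply, Finset.sum_add_distrib]
  conv_lhs => rw [hu]
  simp only [map_sum, map_add, map_smul]
  refine Finset.sum_congr rfl fun k _ => ?_
  simp only [wirtinger, Complex.real_smul]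
  conv_rhs => rw [← Complex.re_add_im (u k)]
  simp only [map_add, map_mul, Complex.conj_ofReal, Complex.conj_I]
  linear_combination ((u k).im * fderiv ℝ f z (Complex.I • stdVec k)) * Complex.I_sq

theorem ContDiffAt.wirtinger {a : Fin n ⊕ Fin n} (hf : ContDiffAt ℝ ∞ f z) :
    ContDiffAt ℝ ∞ (wirtinger a f) z := by
  have h : ContDiffAt ℝ ∞ (fderiv ℝ f) z := hf.fderiv_right (by simp)
  have h' : ∀ v : Cn n, ContDiffAt ℝ ∞ (fun w => fderiv ℝ f w v) z := fun v =>
    h.clm_apply contDiffAt_const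
  rcases a with i | i
  · exact ((h' _).sub (contDiffAt_const.mul (h' _))).div_const 2
  · exact ((h' _).add (contDiffAt_const.mul (h' _))).div_const 2

end Wirtinger

/-! ### Smoothness of the inverse matrix. -/

section MatrixInverse

variable {E : Type*} [NormedAddCommGroup E] [NormedSpace ℝ E] {ι : Type*} [Fintype ι]
  [DecidableEq ι] {g : E → Matrix ι ι ℂ} {z : E} {k : WithTop ℕ∞}

theorem ContDiffAt.matrix_det (hg : ∀ i j, ContDiffAt ℝ k (fun w => g w i j) z) :
    ContDiffAt ℝ k (fun w => (g w).det) z := by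
  simp only [Matrix.det_apply']
  exact ContDiffAt.sum fun σ _ => contDiffAt_const.mul (contDiffAt_prod fun i _ => hg _ _)

theorem ContDiffAt.matrix_inv (hg : ∀ i j, ContDiffAt ℝ k (fun w => g w i j) z)
    (hz : (g z).det ≠ 0) (i j : ι) : ContDiffAt ℝ k (fun w => (g w)⁻¹ i j) z := by
  simp only [Matrix.inv_def, Ring.inverse_eq_inv', Matrix.smul_apply, Matrix.adjugate_apply,
    smul_eq_mul]
  refine ((ContDiffAt.matrix_det hg).inv hz).mul (ContDiffAt.matrix_det fun p q => ?_)
  simp only [Matrix.updateRow_apply]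
  split_ifs
  · exact contDiffAt_const
  · exact hg p q

end MatrixInverse

/-! ### Connection coefficients in terms of the torsion. -/

section Symbols

variable {n : ℕ} (g : Cn n → Matrix (Fin n) (Fin n) ℂ) {z : Cn n}

/-- The torsion `T_{ij l̄} = ∂ᵢ g_{j l̄} - ∂ⱼ g_{i l̄}` of the Chern connection. -/
noncomputable def torsion (z : Cn n) (i j l : Fin n) : ℂ :=
  wirtinger (Sum.inl i) (fun w => g w j l) z - wirtinger (Sum.inl j) (fun w => g w i l) z

variable {g}

theorem inv_complexifiedMetric (hz : IsUnit (g z).det) :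
    (complexifiedMetric g z)⁻¹ = Matrix.fromBlocks 0 ((g z)⁻¹).transpose (g z)⁻¹ 0 := by
  refine Matrix.inv_eq_right_inv ?_
  rw [complexifiedMetric, Matrix.fromBlocks_multiply]
  simp [← Matrix.transpose_mul, Matrix.mul_nonsing_inv _ hz, Matrix.nonsing_inv_mul _ hz]

/-- The Lichnerowicz coefficient is the Chern one symmetrised in `i, j`, so the two differ by half
the torsion. -/
theorem gauduchonSymbol_inl (t : ℝ) (hz : IsUnit (g z).det) (i j k : Fin n) :
    gauduchonSymbol g t z (Sum.inl i) j k
      = ∑ l, (wirtinger (Sum.inl i) (fun w => g w j l) z - (1 - t) / 2 * torsion g z i j l)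
          * (g z)⁻¹ l k := by
  simp only [gauduchonSymbol, chernSymbol, lichnerowiczSymbol, leviCivitaSymbol,
    inv_complexifiedMetric hz]
  simp only [complexifiedMetric, Fintype.sum_sum_type, Matrix.fromBlocks_apply₁₁,
    Matrix.fromBlocks_apply₁₂, Matrix.transpose_apply, Matrix.zero_apply, zero_mul,
    Finset.sum_const_zero, zero_add, wirtinger_const, sub_zero, Finset.mul_sum,
    ← Finset.sum_add_distrib, torsion]
  exact Finset.sum_congr rfl fun l _ => by ring

/-- Only the Lichnerowicz connection contributes in the `(0,1)` directions. -/
theorem gauduchonSymbol_inr (t : ℝ) (hz : IsUnit (g z).det) (i j k : Fin n) :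
    gauduchonSymbol g t z (Sum.inr i) j k
      = ∑ l, (1 - t) / 2 * (wirtinger (Sum.inr i) (fun w => g w j l) z
          - wirtinger (Sum.inr l) (fun w => g w j i) z) * (g z)⁻¹ l k := by
  simp only [gauduchonSymbol, chernSymbol, lichnerowiczSymbol, leviCivitaSymbol,
    inv_complexifiedMetric hz]
  simp only [complexifiedMetric, Fintype.sum_sum_type, Matrix.fromBlocks_apply₁₁,
    Matrix.fromBlocks_apply₁₂, Matrix.fromBlocks_apply₂₁, Matrix.fromBlocks_apply₂₂,
    Matrix.transpose_apply, Matrix.zero_apply, zero_mul, mul_zero,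
    Finset.sum_const_zero, zero_add, add_zero, wirtinger_const, Finset.mul_sum]
  exact Finset.sum_congr rfl fun l _ => by ring

end Symbols

/-! ### Curvature contracted with constant vectors. -/

section Contraction

variable {n : ℕ} {Γ : Cn n → Fin n ⊕ Fin n → Fin n → Fin n → ℂ} {z : Cn n}

/-- Contraction `∑ Γ_{aⱼ k}^p uʲ vᵏ` of connection coefficients in the directions `a j`. -/
noncomputable def contractedSymbol (Γ : Cn n → Fin n ⊕ Fin n → Fin n → Fin n → ℂ) (a : Fin n → Fin n ⊕ Fin n)
    (u v : Fin n → ℂ) (p : Fin n) (w : Cn n) : ℂ :=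
  ∑ j, ∑ k, u j * v k * Γ w (a j) k p

theorem wirtinger_contractedSymbol (hΓ : ∀ a k p, DifferentiableAt ℝ (fun w => Γ w a k p) z)
    (a : Fin n → Fin n ⊕ Fin n) (u v : Fin n → ℂ) (p : Fin n) (b : Fin n ⊕ Fin n) :
    wirtinger b (contractedSymbol Γ a u v p) z
      = ∑ j, ∑ k, u j * v k * wirtinger b (fun w => Γ w (a j) k p) z := by
  have h : ∀ j k, DifferentiableAt ℝ (fun w => u j * v k * Γ w (a j) k p) z := fun j k =>
    (hΓ _ _ _).const_mul _
  unfold contractedSymbol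
  rw [wirtinger_sum _ _ fun j _ => DifferentiableAt.fun_sum fun k _ => h j k]
  refine Finset.sum_congr rfl fun j _ => ?_
  rw [wirtinger_sum _ _ fun k _ => h j k]
  exact Finset.sum_congr rfl fun k _ => wirtinger_const_mul _ _ (hΓ _ _ _)

theorem sum_contractedSymbol_mul (a b : Fin n → Fin n ⊕ Fin n) (u u' v : Fin n → ℂ) (p : Fin n) :
    ∑ q, contractedSymbol Γ a u v q z * ∑ i, u' i * Γ z (b i) q p
      = ∑ i, ∑ j, ∑ k, u' i * u j * v k * ∑ q, Γ z (a j) k q * Γ z (b i) q p := by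
  have h : ∀ q, contractedSymbol Γ a u v q z * ∑ i, u' i * Γ z (b i) q p
      = ∑ i, ∑ j, ∑ k, u' i * u j * v k * (Γ z (a j) k q * Γ z (b i) q p) := fun q => by
    rw [Finset.mul_sum]
    refine Finset.sum_congr rfl fun i _ => ?_
    simp only [contractedSymbol, Finset.sum_mul]
    exact Finset.sum_congr rfl fun j _ => Finset.sum_congr rfl fun k _ => by ring
  simp only [h, Finset.mul_sum]
  exact Finset.sum_comm.trans (Finset.sum_congr rfl fun i _ => Finset.sum_comm.trans
    (Finset.sum_congr rfl fun j _ => Finset.sum_comm))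

/-- Here `u` stands for `v̄` but is an independent constant vector, so `u` and `v` pass through all
derivatives. -/
theorem sum_curvatureCoeff (hΓ : ∀ a k p, DifferentiableAt ℝ (fun w => Γ w a k p) z)
    (u v : Fin n → ℂ) (p : Fin n) :
    ∑ i, ∑ j, ∑ k, v i * u j * v k * curvatureCoeff Γ z (Sum.inl i) (Sum.inr j) k p
      = ∑ i, v i * wirtinger (Sum.inl i) (contractedSymbol Γ Sum.inr u v p) z
        - ∑ j, u j * wirtinger (Sum.inr j) (contractedSymbol Γ Sum.inl v v p) z
        + ∑ q, contractedSymbol Γ Sum.inr u v q z * ∑ i, v i * Γ z (Sum.inl i) q p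
        - ∑ q, contractedSymbol Γ Sum.inl v v q z * ∑ j, u j * Γ z (Sum.inr j) q p := by
  have h₂ : ∑ j, u j * wirtinger (Sum.inr j) (contractedSymbol Γ Sum.inl v v p) z
      = ∑ i, ∑ j, ∑ k, v i * u j * v k * wirtinger (Sum.inr j) (fun w => Γ w (Sum.inl i) k p) z := by
    simp only [wirtinger_contractedSymbol hΓ, Finset.mul_sum]
    rw [Finset.sum_comm]
    exact Finset.sum_congr rfl fun i _ => Finset.sum_congr rfl fun j _ =>
      Finset.sum_congr rfl fun k _ => by ring
  have h₄ := sum_contractedSymbol_mul (Γ := Γ) (z := z) Sum.inl Sum.inr v u v p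
  rw [Finset.sum_comm] at h₄
  rw [h₂, h₄, sum_contractedSymbol_mul]
  simp only [wirtinger_contractedSymbol hΓ, Finset.mul_sum, ← Finset.sum_add_distrib,
    ← Finset.sum_sub_distrib]
  refine Finset.sum_congr rfl fun i _ => Finset.sum_congr rfl fun j _ =>
    Finset.sum_congr rfl fun k _ => ?_
  simp only [curvatureCoeff, Finset.sum_sub_distrib, ← Finset.mul_sum]
  ring

theorem sum_lowered_curvatureCoeff (g : Matrix (Fin n) (Fin n) ℂ)
    (hΓ : ∀ a k p, DifferentiableAt ℝ (fun w => Γ w a k p) z) (u v : Fin n → ℂ) :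
    ∑ i, ∑ j, ∑ k, ∑ l, (∑ p, curvatureCoeff Γ z (Sum.inl i) (Sum.inr j) k p * g p l)
        * v i * u j * v k * u l
      = ∑ p, (∑ i, v i * wirtinger (Sum.inl i) (contractedSymbol Γ Sum.inr u v p) z
        - ∑ j, u j * wirtinger (Sum.inr j) (contractedSymbol Γ Sum.inl v v p) z
        + ∑ q, contractedSymbol Γ Sum.inr u v q z * ∑ i, v i * Γ z (Sum.inl i) q p
        - ∑ q, contractedSymbol Γ Sum.inl v v q z * ∑ j, u j * Γ z (Sum.inr j) q p)
          * ∑ l, g p l * u l := by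
  simp only [← sum_curvatureCoeff hΓ]
  have h : ∀ i j k, ∑ l, (∑ p, curvatureCoeff Γ z (Sum.inl i) (Sum.inr j) k p * g p l)
        * v i * u j * v k * u l
      = ∑ p, v i * u j * v k * curvatureCoeff Γ z (Sum.inl i) (Sum.inr j) k p
          * ∑ l, g p l * u l := fun i j k => by
    simp only [Finset.sum_mul, Finset.mul_sum]
    rw [Finset.sum_comm]
    exact Finset.sum_congr rfl fun p _ => Finset.sum_congr rfl fun l _ => by ring
  simp only [h]
  refine ((Finset.sum_congr rfl fun i _ => (Finset.sum_congr rfl fun j _ =>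
    Finset.sum_comm).trans Finset.sum_comm).trans Finset.sum_comm).trans ?_
  simp only [Finset.sum_mul]

end Contraction

/-! ### The dependence of the contracted curvature on `t`. -/

section Gauduchon

variable {n : ℕ} {g : Cn n → Matrix (Fin n) (Fin n) ℂ} {z : Cn n}

theorem sum_mul_inv_mul (hz : IsUnit (g z).det) (c : Fin n → ℂ) (m : Fin n) :
    ∑ p, (∑ l, c l * (g z)⁻¹ l p) * g z p m = c m := by
  have h : (Matrix.vecMul (Matrix.vecMul c (g z)⁻¹) (g z)) m = c m := by
    rw [Matrix.vecMul_vecMul, Matrix.nonsing_inv_mul _ hz, Matrix.vecMul_one]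
  simpa [Matrix.vecMul, dotProduct] using h

theorem sum_mul_inv_mul_sum (hz : IsUnit (g z).det) (c u : Fin n → ℂ) :
    ∑ p, (∑ l, c l * (g z)⁻¹ l p) * ∑ m, g z p m * u m = ∑ m, c m * u m := by
  have h : ∀ m, c m * u m = (∑ p, (∑ l, c l * (g z)⁻¹ l p) * g z p m) * u m := fun m => by
    rw [sum_mul_inv_mul hz c]
  simp only [h, Finset.mul_sum, Finset.sum_mul]
  rw [Finset.sum_comm]
  refine Finset.sum_congr rfl fun m _ => Finset.sum_congr rfl fun p _ =>
    Finset.sum_congr rfl fun l _ => by ring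

theorem sum_antisymm_eq_zero {ι : Type*} [Fintype ι] (F : ι → ι → ℂ)
    (hF : ∀ i j, F i j = -F j i) : ∑ i, ∑ j, F i j = 0 := by
  have h : ∑ i, ∑ j, F i j = -∑ i, ∑ j, F i j := by
    conv_lhs => rw [Finset.sum_comm]
    simp only [← Finset.sum_neg_distrib]
    exact Finset.sum_congr rfl fun i _ => Finset.sum_congr rfl fun j _ => hF _ _
  linear_combination (1 / 2) * h

variable (g) in
/-- The contraction `T_{v q v̄} = ∑ vⁱ ūˡ T_{i q l̄}` of the torsion. -/
noncomputable def contractedTorsion (z : Cn n) (v u : Fin n → ℂ) (q : Fin n) : ℂ :=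
  ∑ i, ∑ l, v i * u l * torsion g z i q l

variable (g) in
/-- The conjugate torsion `∂_j̄ g_{q l̄} - ∂_l̄ g_{q j̄}`. -/
noncomputable def conjTorsion (z : Cn n) (j q l : Fin n) : ℂ :=
  wirtinger (Sum.inr j) (fun w => g w q l) z - wirtinger (Sum.inr l) (fun w => g w q j) z

/-- The difference from Chern is a multiple of the torsion, antisymmetric in the two lower indices,
and both are contracted with `v`. -/
theorem contractedSymbol_gauduchonSymbol_inl (t : ℝ) (hz : IsUnit (g z).det) (v : Fin n → ℂ)
    (p : Fin n) :
    contractedSymbol (gauduchonSymbol g t) Sum.inl v v p z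
      = contractedSymbol (chernSymbol g) Sum.inl v v p z := by
  rw [← sub_eq_zero]
  simp only [contractedSymbol, gauduchonSymbol_inl t hz, chernSymbol, ← Finset.sum_sub_distrib]
  refine sum_antisymm_eq_zero _ fun i j => ?_
  simp only [← mul_sub, ← Finset.sum_sub_distrib, ← Finset.sum_neg_distrib, Finset.mul_sum, torsion]
  exact Finset.sum_congr rfl fun l _ => by ring

/-- Lowering `p` leaves `conjTorsion g z j q l`, antisymmetric in `j, l`, contracted with `u j * u
l`. -/
theorem sum_gauduchonSymbol_inr_mul (t : ℝ) (hz : IsUnit (g z).det) (u : Fin n → ℂ) (q : Fin n) :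
    ∑ p, (∑ j, u j * gauduchonSymbol g t z (Sum.inr j) q p) * ∑ m, g z p m * u m = 0 := by
  have h : ∀ p, ∑ j, u j * gauduchonSymbol g t z (Sum.inr j) q p
      = ∑ l, (∑ j, (1 - t) / 2 * u j * conjTorsion g z j q l) * (g z)⁻¹ l p := fun p => by
    simp only [gauduchonSymbol_inr t hz, Finset.mul_sum, Finset.sum_mul, conjTorsion]
    rw [Finset.sum_comm]
    exact Finset.sum_congr rfl fun l _ => Finset.sum_congr rfl fun j _ => by ring
  simp only [h]
  rw [sum_mul_inv_mul_sum hz]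
  simp only [Finset.sum_mul]
  exact sum_antisymm_eq_zero _ fun i j => by simp only [conjTorsion]; ring

theorem sum_gauduchonSymbol_inl_mul (t : ℝ) (hz : IsUnit (g z).det) (u v : Fin n → ℂ)
    (q : Fin n) :
    ∑ p, (∑ i, v i * gauduchonSymbol g t z (Sum.inl i) q p) * ∑ m, g z p m * u m
      = ∑ i, v i * ∑ m, wirtinger (Sum.inl i) (fun w => g w q m) z * u m
        - (1 - t) / 2 * contractedTorsion g z v u q := by
  have h : ∀ p, ∑ i, v i * gauduchonSymbol g t z (Sum.inl i) q p
      = ∑ l, (∑ i, v i * (wirtinger (Sum.inl i) (fun w => g w q l) z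
          - (1 - t) / 2 * torsion g z i q l)) * (g z)⁻¹ l p := fun p => by
    simp only [gauduchonSymbol_inl t hz, Finset.mul_sum, Finset.sum_mul]
    rw [Finset.sum_comm]
    exact Finset.sum_congr rfl fun l _ => Finset.sum_congr rfl fun j _ => by ring
  simp only [h]
  rw [sum_mul_inv_mul_sum hz]
  simp only [Finset.sum_mul, Finset.mul_sum, contractedTorsion]
  rw [Finset.sum_comm]
  simp only [← Finset.sum_sub_distrib]
  exact Finset.sum_congr rfl fun l _ => Finset.sum_congr rfl fun j _ => by ring

theorem contractedSymbol_gauduchonSymbol_inr (t : ℝ) (hz : IsUnit (g z).det) (u v : Fin n → ℂ)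
    (p : Fin n) :
    contractedSymbol (gauduchonSymbol g t) Sum.inr u v p z
      = (1 - t) / 2 * ∑ l, (∑ j, ∑ k, u j * v k * conjTorsion g z j k l) * (g z)⁻¹ l p := by
  simp only [contractedSymbol, gauduchonSymbol_inr t hz, Finset.mul_sum, Finset.sum_mul,
    conjTorsion]
  refine (Finset.sum_congr rfl fun j _ => Finset.sum_comm).trans ?_
  rw [Finset.sum_comm]
  exact Finset.sum_congr rfl fun l _ => Finset.sum_congr rfl fun j _ =>
    Finset.sum_congr rfl fun k _ => by ring

theorem sum_contractedSymbol_gauduchonSymbol_inr (t : ℝ) (hz : IsUnit (g z).det)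
    (u v : Fin n → ℂ) :
    ∑ p, contractedSymbol (gauduchonSymbol g t) Sum.inr u v p z * ∑ m, g z p m * u m = 0 := by
  have h : ∀ p, contractedSymbol (gauduchonSymbol g t) Sum.inr u v p z
      = ∑ k, v k * ∑ j, u j * gauduchonSymbol g t z (Sum.inr j) k p := fun p => by
    simp only [contractedSymbol, Finset.mul_sum]
    rw [Finset.sum_comm]
    exact Finset.sum_congr rfl fun k _ => Finset.sum_congr rfl fun j _ => by ring
  simp only [h, Finset.sum_mul (s := Finset.univ) (f := fun k => v k * _)]
  rw [Finset.sum_comm]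
  refine Finset.sum_eq_zero fun k _ => ?_
  simp only [mul_assoc, ← Finset.mul_sum, sum_gauduchonSymbol_inr_mul t hz, mul_zero]

theorem differentiableAt_gauduchonSymbol (hg : ∀ i j, ContDiffAt ℝ ∞ (fun w => g w i j) z)
    (hz : ∀ᶠ w in nhds z, IsUnit (g w).det) (t : ℝ) (a : Fin n ⊕ Fin n) (k p : Fin n) :
    DifferentiableAt ℝ (fun w => gauduchonSymbol g t w a k p) z := by
  have hi : ∀ i j, DifferentiableAt ℝ (fun w => (g w)⁻¹ i j) z := fun i j =>
    (ContDiffAt.matrix_inv hg hz.self_of_nhds.ne_zero i j).differentiableAt (by simp)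
  have hd : ∀ a i j, DifferentiableAt ℝ (wirtinger a fun w => g w i j) z := fun a i j =>
    (ContDiffAt.wirtinger (hg i j)).differentiableAt (by simp)
  rcases a with i | i
  · refine DifferentiableAt.congr_of_eventuallyEq ?_
      (hz.mono fun w hw => gauduchonSymbol_inl t hw i k p)
    exact DifferentiableAt.fun_sum fun l _ =>
      ((hd _ _ _).sub (((hd _ _ _).sub (hd _ _ _)).const_mul _)).mul (hi _ _)
  · refine DifferentiableAt.congr_of_eventuallyEq ?_
      (hz.mono fun w hw => gauduchonSymbol_inr t hw i k p)
    exact DifferentiableAt.fun_sum fun l _ =>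
      (((hd _ _ _).sub (hd _ _ _)).const_mul _).mul (hi _ _)

/-- The first term on the right is free of `t`; it is the Chern value, as `t = 1` shows, and need
not be evaluated. Only the product of the `(0,1)` coefficients `A` with the `(1,0)` ones yields the
second: each factor carries one `(1 - t) / 2`. -/
theorem sum_gauduchonCurvature (hg : ∀ i j, ContDiffAt ℝ ∞ (fun w => g w i j) z)
    (hz : ∀ᶠ w in nhds z, IsUnit (g w).det) (t : ℝ) (u v : Fin n → ℂ) :
    ∑ i, ∑ j, ∑ k, ∑ l, gauduchonCurvature g t z i j k l * v i * u j * v k * u l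
      = -∑ p, (∑ j, u j * wirtinger (Sum.inr j) (contractedSymbol (chernSymbol g) Sum.inl v v p) z)
            * ∑ m, g z p m * u m
        - ((1 - t) / 2) ^ 2 * ∑ p, (∑ l, (∑ j, ∑ k, u j * v k * conjTorsion g z j k l)
            * (g z)⁻¹ l p) * contractedTorsion g z v u p := by
  have hΓ := differentiableAt_gauduchonSymbol hg hz t
  have hgd : ∀ i j, DifferentiableAt ℝ (fun w => g w i j) z := fun i j =>
    (hg i j).differentiableAt (by simp)
  have hu := hz.self_of_nhds
  set A := contractedSymbol (gauduchonSymbol g t) Sum.inr u v with hA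
  set a : ℂ := (1 - t) / 2 with ha
  have hAd : ∀ p, DifferentiableAt ℝ (A p) z := fun p =>
    DifferentiableAt.fun_sum fun j _ => DifferentiableAt.fun_sum fun k _ => (hΓ _ _ _).const_mul _
  have hGd : ∀ p, DifferentiableAt ℝ (fun w => ∑ m, g w p m * u m) z := fun p =>
    DifferentiableAt.fun_sum fun m _ => (hgd _ _).mul_const _
  have hdG : ∀ i p, wirtinger (Sum.inl i) (fun w => ∑ m, g w p m * u m) z
      = ∑ m, wirtinger (Sum.inl i) (fun w => g w p m) z * u m := fun i p => by
    rw [wirtinger_sum _ _ fun m _ => (hgd _ _).mul_const _]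
    refine Finset.sum_congr rfl fun m _ => ?_
    rw [wirtinger_mul _ (hgd _ _) (differentiableAt_const _), wirtinger_const, mul_zero, add_zero]
  -- The pairing of `A` with the lowered `u` vanishes in a whole neighbourhood of `z`, so it may be
  -- differentiated; this trades `∂A` for `-A ∂g`.
  have h₁ : ∀ i, ∑ p, (wirtinger (Sum.inl i) (A p) z * ∑ m, g z p m * u m
      + A p z * ∑ m, wirtinger (Sum.inl i) (fun w => g w p m) z * u m) = 0 := fun i => by
    have h : wirtinger (Sum.inl i) (fun w => ∑ p, A p w * ∑ m, g w p m * u m) z = 0 := by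
      rw [wirtinger_congr (f₂ := fun _ => 0) _
        (hz.mono fun w hw => sum_contractedSymbol_gauduchonSymbol_inr t hw u v), wirtinger_const]
    rw [wirtinger_sum _ _ fun p _ => (hAd p).fun_mul (hGd p)] at h
    rw [← h]
    refine Finset.sum_congr rfl fun p _ => ?_
    rw [wirtinger_mul _ (hAd p) (hGd p), hdG]
  have h₁' : ∑ p, (∑ i, v i * wirtinger (Sum.inl i) (A p) z) * ∑ m, g z p m * u m
      = -∑ p, A p z * ∑ i, v i * ∑ m, wirtinger (Sum.inl i) (fun w => g w p m) z * u m := by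
    have h : ∑ i, v i * ∑ p, (wirtinger (Sum.inl i) (A p) z * ∑ m, g z p m * u m
      + A p z * ∑ m, wirtinger (Sum.inl i) (fun w => g w p m) z * u m) = 0 := by
      simp only [h₁, mul_zero, Finset.sum_const_zero]
    rw [← add_eq_zero_iff_eq_neg, ← h, ← Finset.sum_add_distrib]
    simp only [Finset.mul_sum (s := Finset.univ) (f := fun p => wirtinger _ (A p) z * _ + _)]
    rw [Finset.sum_comm]
    refine Finset.sum_congr rfl fun p _ => ?_
    rw [Finset.sum_mul, Finset.mul_sum, ← Finset.sum_add_distrib]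
    exact Finset.sum_congr rfl fun i _ => by ring
  have hB : ∀ j p, wirtinger (Sum.inr j)
      (contractedSymbol (gauduchonSymbol g t) Sum.inl v v p) z
      = wirtinger (Sum.inr j) (contractedSymbol (chernSymbol g) Sum.inl v v p) z := fun j p =>
    wirtinger_congr _ (hz.mono fun w hw => contractedSymbol_gauduchonSymbol_inl t hw v p)
  have h₃ : ∑ p, (∑ q, A q z * ∑ i, v i * gauduchonSymbol g t z (Sum.inl i) q p)
        * ∑ m, g z p m * u m
      = ∑ q, A q z * (∑ i, v i * ∑ m, wirtinger (Sum.inl i) (fun w => g w q m) z * u m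
        - a * contractedTorsion g z v u q) := by
    simp only [← sum_gauduchonSymbol_inl_mul t hu, a]
    simp only [Finset.sum_mul (s := Finset.univ) (f := fun q => A q z * _)]
    rw [Finset.sum_comm]
    simp only [mul_assoc, Finset.mul_sum (s := Finset.univ) (f := fun p => (∑ i, _) * _)]
  have h₄ : ∑ p, (∑ q, contractedSymbol (gauduchonSymbol g t) Sum.inl v v q z
        * ∑ j, u j * gauduchonSymbol g t z (Sum.inr j) q p) * ∑ m, g z p m * u m = 0 := by
    simp only [Finset.sum_mul (s := Finset.univ)
      (f := fun q => contractedSymbol (gauduchonSymbol g t) Sum.inl v v q z * _)]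
    rw [Finset.sum_comm]
    refine Finset.sum_eq_zero fun q _ => ?_
    simp only [mul_assoc, ← Finset.mul_sum (s := Finset.univ) (f := fun p => (∑ j, _) * _),
      sum_gauduchonSymbol_inr_mul t hu, mul_zero]
  have h₅ : ∑ p, A p z * (a * contractedTorsion g z v u p)
      = a ^ 2 * ∑ p, (∑ l, (∑ j, ∑ k, u j * v k * conjTorsion g z j k l)
            * (g z)⁻¹ l p) * contractedTorsion g z v u p := by
    simp only [hA, contractedSymbol_gauduchonSymbol_inr t hu]
    rw [Finset.mul_sum]
    exact Finset.sum_congr rfl fun p _ => by ring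
  unfold gauduchonCurvature
  rw [sum_lowered_curvatureCoeff (g z) hΓ u v]
  simp only [add_mul, sub_mul, Finset.sum_add_distrib, Finset.sum_sub_distrib, ← hA, hB]
  -- The `A ∂g` terms of `h₁'` and `h₃` cancel, leaving only the torsion term of `h₃`.
  rw [h₁', h₃, h₄, ← h₅]
  simp only [mul_sub, Finset.sum_sub_distrib]
  ring

end Gauduchon

/-! ### Vanishing of the torsion. -/

section Vanishing

open scoped ComplexOrder

variable {n : ℕ} {g : Cn n → Matrix (Fin n) (Fin n) ℂ} {z : Cn n}

theorem wirtinger_inr_eq_conj (hg : ∀ i j, DifferentiableAt ℝ (fun w => g w i j) z)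
    (hH : ∀ᶠ w in nhds z, (g w).IsHermitian) (k i j : Fin n) :
    wirtinger (Sum.inr k) (fun w => g w i j) z
      = conj (wirtinger (Sum.inl k) (fun w => g w j i) z) := by
  rw [← wirtinger_inr_conj k (hg j i)]
  exact wirtinger_congr _ (hH.mono fun w hw => (hw.apply i j).symm)

theorem conjTorsion_eq_conj (hg : ∀ i j, DifferentiableAt ℝ (fun w => g w i j) z)
    (hH : ∀ᶠ w in nhds z, (g w).IsHermitian) (j q l : Fin n) :
    conjTorsion g z j q l = conj (torsion g z j l q) := by
  simp only [conjTorsion, torsion, wirtinger_inr_eq_conj hg hH, map_sub]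

/-- Polarisation over `ℂ`: an operator with `⟪A x, x⟫ = 0` for all `x` is zero. -/
theorem matrix_eq_zero_of_sesquilinear {M : Matrix (Fin n) (Fin n) ℂ}
    (hM : ∀ v : Fin n → ℂ, ∑ i, ∑ l, v i * conj (v l) * M i l = 0) : M = 0 := by
  have h : Matrix.toEuclideanLin M.transpose = 0 := by
    rw [← inner_map_self_eq_zero]
    intro x
    rw [← map_zero (starRingEnd ℂ), ← hM x, Finset.sum_comm]
    simp only [Matrix.toLpLin_apply, EuclideanSpace.inner_eq_star_dotProduct, dotProduct,
      map_sum]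
    refine Finset.sum_congr rfl fun i _ => ?_
    change x i * star (∑ j, M j i * x j) = _
    rw [star_sum, Finset.mul_sum]
    refine Finset.sum_congr rfl fun j _ => ?_
    simp [mul_comm, mul_left_comm]
  simpa using h

theorem torsion_eq_zero_of_re_gauduchonCurvature_eq
    (hg : ∀ i j, ContDiffAt ℝ ∞ (fun w => g w i j) z) (hpd : ∀ᶠ w in nhds z, (g w).PosDef)
    {t s : ℝ} (hts : ((1 - t) / 2) ^ 2 ≠ ((1 - s) / 2) ^ 2)
    (hv : ∀ v : Fin n → ℂ,
      (∑ i, ∑ j, ∑ k, ∑ l,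
        gauduchonCurvature g t z i j k l * v i * conj (v j) * v k * conj (v l)).re
      = (∑ i, ∑ j, ∑ k, ∑ l,
        gauduchonCurvature g s z i j k l * v i * conj (v j) * v k * conj (v l)).re)
    (i j l : Fin n) : torsion g z i j l = 0 := by
  have hz : ∀ᶠ w in nhds z, IsUnit (g w).det := hpd.mono fun w hw => hw.det_pos.ne'.isUnit
  have hgd : ∀ i j, DifferentiableAt ℝ (fun w => g w i j) z := fun i j =>
    (hg i j).differentiableAt (by simp)
  have hT : ∀ v : Fin n → ℂ, contractedTorsion g z v (fun i => conj (v i)) = 0 := by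
    intro v
    by_contra hne
    set T := contractedTorsion g z v fun i => conj (v i) with hTdef
    have hc : ∀ p, ∑ j, ∑ k, conj (v j) * v k * conjTorsion g z j k p = conj (T p) := fun p => by
      simp only [hTdef, contractedTorsion, map_sum, map_mul, Complex.conj_conj,
        conjTorsion_eq_conj hgd (hpd.mono fun w hw => hw.isHermitian)]
    -- This is `|T_v|²`, positive because the inverse of a positive definite matrix is positive
    -- definite.
    have hQ : 0 < (star T ⬝ᵥ ((g z)⁻¹.mulVec T)).re :=
      (Complex.lt_def.1 (hpd.self_of_nhds.inv.dotProduct_mulVec_pos hne)).1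
    have hQ' : ∑ p, (∑ l, conj (T l) * (g z)⁻¹ l p) * T p = star T ⬝ᵥ ((g z)⁻¹.mulVec T) := by
      rw [Matrix.dotProduct_mulVec]
      rfl
    have h := hv v
    rw [sum_gauduchonCurvature hg hz t (fun i => conj (v i)) v,
      sum_gauduchonCurvature hg hz s (fun i => conj (v i)) v] at h
    simp only [hc, ← hTdef, hQ', Complex.sub_re] at h
    have hre : ∀ r : ℝ, (((1 - r) / 2 : ℂ) ^ 2 * (star T ⬝ᵥ ((g z)⁻¹.mulVec T))).re
        = ((1 - r) / 2) ^ 2 * (star T ⬝ᵥ ((g z)⁻¹.mulVec T)).re := fun r => by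
      rw [← Complex.re_ofReal_mul]
      norm_num
    rw [hre, hre] at h
    exact hts (mul_right_cancel₀ hQ.ne' (by linarith))
  -- For fixed middle index `j`, the contracted torsion is a sesquilinear form in `v`.
  have h := matrix_eq_zero_of_sesquilinear (M := Matrix.of fun i l => torsion g z i j l)
    fun v => by simpa [contractedTorsion] using congrFun (hT v) j
  exact congrFun (congrFun h i) l

end Vanishing

/-! ### Vanishing torsion implies `dω = 0`. -/

section ExteriorDerivative

variable {n : ℕ} {g : Cn n → Matrix (Fin n) (Fin n) ℂ} {z : Cn n}

theorem wedge_apply (α β : Cn n →L[ℝ] ℂ) (v : Fin 2 → Cn n) :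
    wedge α β v = α (v 0) * β (v 1) - α (v 1) * β (v 0) := by
  have h : (Finset.univ : Finset (Equiv.Perm (Fin 2))) = {1, Equiv.swap 0 1} := by decide
  rw [wedge, ContinuousMultilinearMap.alternatization_apply_apply, h,
    Finset.sum_pair (by decide)]
  simp [sub_eq_add_neg]

theorem fundamentalForm_apply (w : Cn n) (v : Fin 2 → Cn n) :
    fundamentalForm g w v
      = ∑ i, ∑ j, (Complex.I * g w i j) * wedge (dz i) (dzbar j) v := by
  simp [fundamentalForm, ContinuousAlternatingMap.sum_apply]

theorem differentiableAt_fundamentalForm (hg : ∀ i j, DifferentiableAt ℝ (fun w => g w i j) z) :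
    DifferentiableAt ℝ (fundamentalForm g) z :=
  DifferentiableAt.fun_sum fun i _ => DifferentiableAt.fun_sum fun j _ =>
    ((hg i j).const_mul Complex.I).smul_const (wedge (dz i) (dzbar j))

/-- Split the derivative of `g` into its `∂` part `P` and `∂̄` part `N`. Zero torsion makes `P`
symmetric in the derivative slot and the `dz` slot; its conjugate makes `N` symmetric in the
derivative slot and the `dz̄` slot. Alternation kills both. -/
theorem extDeriv_fundamentalForm_eq_zero (hg : ∀ i j, DifferentiableAt ℝ (fun w => g w i j) z)
    (hH : ∀ᶠ w in nhds z, (g w).IsHermitian) (hT : ∀ i j l, torsion g z i j l = 0) :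
    extDeriv (fundamentalForm g) z = 0 := by
  set S : Cn n → Cn n → Cn n → ℂ := fun a b c => ∑ i, ∑ j,
    fderiv ℝ (fun w => g w i j) z a * (b i * conj (c j)) with hS
  set P : Cn n → Cn n → Cn n → ℂ := fun a b c => ∑ i, ∑ j, ∑ k,
    wirtinger (Sum.inl k) (fun w => g w i j) z * a k * (b i * conj (c j)) with hP
  set N : Cn n → Cn n → Cn n → ℂ := fun a b c => ∑ i, ∑ j, ∑ k,
    wirtinger (Sum.inr k) (fun w => g w i j) z * conj (a k) * (b i * conj (c j)) with hN
  have hSPN : ∀ a b c, S a b c = P a b c + N a b c := fun a b c => by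
    simp only [hS, hP, hN, ← Finset.sum_add_distrib, fderiv_eq_sum_wirtinger, Finset.sum_mul,
      add_mul]
  have hPsymm : ∀ a b c, P a b c = P b a c := fun a b c => by
    simp only [hP]
    refine (Finset.sum_congr rfl fun i _ => Finset.sum_comm).trans ?_
    rw [Finset.sum_comm]
    refine Finset.sum_congr rfl fun k _ => ?_
    rw [Finset.sum_comm]
    refine Finset.sum_congr rfl fun j _ => Finset.sum_congr rfl fun i _ => ?_
    rw [sub_eq_zero.1 (hT k i j)]
    ring
  have hNsymm : ∀ a b c, N a b c = N c b a := fun a b c => by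
    simp only [hN]
    refine Finset.sum_congr rfl fun i _ => ?_
    rw [Finset.sum_comm]
    refine Finset.sum_congr rfl fun k _ => Finset.sum_congr rfl fun j _ => ?_
    rw [wirtinger_inr_eq_conj hg hH, wirtinger_inr_eq_conj hg hH, sub_eq_zero.1 (hT k j i)]
    ring
  have hform : ∀ (u : Cn n) (v : Fin 2 → Cn n), fderiv ℝ (fun w => fundamentalForm g w v) z u
      = Complex.I * (S u (v 0) (v 1) - S u (v 1) (v 0)) := fun u v => by
    have h : HasFDerivAt (fun w => fundamentalForm g w v)
        (∑ i, ∑ j, (Complex.I • fderiv ℝ (fun w => g w i j) z).smulRight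
          (wedge (dz i) (dzbar j) v)) z := by
      simp only [fundamentalForm_apply]
      exact HasFDerivAt.fun_sum fun i _ => HasFDerivAt.fun_sum fun j _ =>
        ((hg i j).hasFDerivAt.const_mul Complex.I).smul_const (wedge (dz i) (dzbar j) v)
    rw [h.fderiv]
    simp only [hS, ← Finset.sum_sub_distrib, Finset.mul_sum, sum_apply,
      ContinuousLinearMap.smulRight_apply, wedge_apply]
    refine Finset.sum_congr rfl fun i _ => Finset.sum_congr rfl fun j _ => ?_
    simp [dz, dzbar]
    ring
  ext v
  rw [extDeriv_apply (differentiableAt_fundamentalForm hg)]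
  refine (Fin.sum_univ_three _).trans ?_
  simp only [hform, hSPN, Fin.removeNth]
  simp [Fin.succAbove]
  -- Each rewrite matches one of the six pairs of terms with opposite signs.
  rw [hPsymm (v 0) (v 1), hPsymm (v 0) (v 2), hPsymm (v 1) (v 2), hNsymm (v 0) (v 1) (v 2),
    hNsymm (v 0) (v 2) (v 1), hNsymm (v 1) (v 0) (v 2)]
  ring

end ExteriorDerivative

/-! ### From coordinates to the manifold. -/

namespace HermitianMetric

open scoped ComplexOrder

theorem sum_smul_coordVec {n : ℕ} {M : Type*} [TopologicalSpace M] [ChartedSpace (Cn n) M]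
    (φ : OpenPartialHomeomorph M (Cn n))
    (z : Cn n) (c : Fin n → ℂ) :
    ∑ i, c i • coordVec φ z i
      = mfderiv 𝓘(ℂ, Cn n) 𝓘(ℂ, Cn n) φ.symm z (WithLp.toLp 2 c : Cn n) := by
  have hc : (WithLp.toLp 2 c : Cn n) = ∑ i, c i • stdVec i := by
    ext j
    simp [stdVec, Pi.single_apply]
  simp only [coordVec]
  rw [hc]
  erw [map_sum]
  exact Finset.sum_congr rfl fun i _ => (map_smul _ _ _).symm

variable {n : ℕ} {M : Type*} [TopologicalSpace M] [ChartedSpace (Cn n) M]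
  [IsManifold 𝓘(ℂ, Cn n) ω M]

theorem mdifferentiable_of_mem_atlas {φ : OpenPartialHomeomorph M (Cn n)}
    (hφ : φ ∈ atlas (Cn n) M) : φ.MDifferentiable 𝓘(ℂ, Cn n) 𝓘(ℂ, Cn n) :=
  haveI : IsManifold 𝓘(ℂ, Cn n) 1 M := IsManifold.of_le (n := ω) le_top
  _root_.mdifferentiable_of_mem_atlas hφ

theorem form_sum_coordVec (h : HermitianMetric n M) (φ : OpenPartialHomeomorph M (Cn n))
    (z : Cn n) (c : Fin n → ℂ) :
    h.form (φ.symm z) (∑ i, c i • coordVec φ z i) (∑ i, c i • coordVec φ z i)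
      = ∑ i, ∑ j, c i * conj (c j) * h.coeff φ z i j := by
  simp only [map_sum, LinearMap.sum_apply, map_smul, LinearMap.smul_apply, LinearMap.map_smulₛₗ,
    smul_eq_mul, coeff, Matrix.of_apply, Finset.mul_sum]
  rw [Finset.sum_comm]
  exact Finset.sum_congr rfl fun i _ => Finset.sum_congr rfl fun j _ => by ring

theorem posDef_coeff (h : HermitianMetric n M) {φ : OpenPartialHomeomorph M (Cn n)}
    (hφ : φ ∈ atlas (Cn n) M) {z : Cn n} (hz : z ∈ φ.target) : (h.coeff φ z).PosDef := by
  have hH : (h.coeff φ z).IsHermitian := Matrix.IsHermitian.ext fun i j => h.conj_symm _ _ _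
  refine Matrix.PosDef.of_dotProduct_mulVec_pos hH fun x hx => ?_
  -- The conjugate appears because `form` is linear in its first variable, whereas `star x ⬝ᵥ
  -- (h.coeff φ z).mulVec x` conjugates the first.
  set w := ∑ i, star x i • coordVec φ z i with hw
  have hw0 : w ≠ 0 := by
    rw [hw, sum_smul_coordVec]
    intro h0
    have := (mdifferentiable_of_mem_atlas hφ).symm.mfderiv_injective hz
      (h0.trans (map_zero _).symm)
    refine hx (funext fun i => ?_)
    have hi : star x i = 0 := congrArg (fun y : Cn n => y i) this
    simpa using hi
  have hsum : star x ⬝ᵥ ((h.coeff φ z).mulVec x) = h.form (φ.symm z) w w := by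
    rw [hw, form_sum_coordVec]
    simp only [dotProduct, Matrix.mulVec, Finset.mul_sum]
    refine Finset.sum_congr rfl fun i _ => Finset.sum_congr rfl fun j _ => ?_
    simp
    ring
  rw [hsum, Complex.lt_def]
  refine ⟨h.pos_def _ w hw0, ?_⟩
  exact (Complex.conj_eq_iff_im.1 (h.conj_symm _ w w)).symm

theorem components_surjective (x : M) :
    Function.Surjective (components x : TangentSpace 𝓘(ℂ, Cn n) x → Cn n) :=
  (mdifferentiable_of_mem_atlas (chart_mem_atlas (Cn n) x)).mfderiv_surjective
    (mem_chart_source (Cn n) x)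

theorem isKahler_of_gauduchonHSC_eq (h : HermitianMetric n M) {t s : ℝ}
    (hts : ((1 - t) / 2) ^ 2 ≠ ((1 - s) / 2) ^ 2)
    (hHSC : ∀ (x : M) (v : TangentSpace 𝓘(ℂ, Cn n) x), v ≠ 0 →
      h.gauduchonHSC t x v = h.gauduchonHSC s x v) : h.IsKahler := by
  intro x
  have hφ := chart_mem_atlas (Cn n) x
  set φ := chartAt (Cn n) x
  have hx : φ x ∈ φ.target := φ.map_source (mem_chart_source (Cn n) x)
  have hnhds := φ.open_target.mem_nhds hx
  have hg : ∀ i j, ContDiffAt ℝ ∞ (fun w => h.coeff φ w i j) (φ x) := fun i j =>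
    (h.smooth φ hφ i j).contDiffAt hnhds
  have hpd : ∀ᶠ w in nhds (φ x), (h.coeff φ w).PosDef :=
    Filter.mem_of_superset hnhds fun w hw => h.posDef_coeff hφ hw
  refine extDeriv_fundamentalForm_eq_zero (fun i j => (hg i j).differentiableAt (by simp))
    (hpd.mono fun w hw => hw.isHermitian)
    (torsion_eq_zero_of_re_gauduchonCurvature_eq hg hpd hts fun c => ?_)
  -- Every coordinate vector comes from a tangent vector, so the hypothesis tests all `c`; the
  -- common denominator `|v|⁴` then cancels.
  obtain ⟨v, hv⟩ := components_surjective x (WithLp.toLp 2 c)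
  have hR : ∀ r : ℝ, (h.gauduchonR r x v v v v) = ∑ i, ∑ j, ∑ k, ∑ l,
      gauduchonCurvature (h.coeff φ) r (φ x) i j k l * c i * conj (c j) * c k * conj (c l) :=
    fun r => by simp only [gauduchonR, hv]; rfl
  rw [← hR, ← hR]
  by_cases hv0 : v = 0
  · subst hv0
    have h0 : components x (0 : TangentSpace 𝓘(ℂ, Cn n) x) = 0 := map_zero _
    simp [gauduchonR, h0]
  · exact (div_left_inj' (pow_ne_zero 2 (h.pos_def x v hv0).ne')).1 (hHSC x v hv0)

end HermitianMetric

end HermitianGeometry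

theorem mainTheorem5 {n : ℕ} {M : Type*} [TopologicalSpace M]
    [ChartedSpace (HermitianGeometry.Cn n) M]
    [IsManifold 𝓘(ℂ, HermitianGeometry.Cn n) ω M]
    (h : HermitianGeometry.HermitianMetric n M) (t s : ℝ)
    (hHSC : ∀ (x : M) (v : TangentSpace 𝓘(ℂ, HermitianGeometry.Cn n) x), v ≠ 0 →
      h.gauduchonHSC t x v = h.gauduchonHSC s x v) :
    t = s ∨ t = 2 - s ∨ h.IsKahler := by
  by_cases hts : ((1 - t) / 2) ^ 2 = ((1 - s) / 2) ^ 2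
  · rcases sq_eq_sq_iff_eq_or_eq_neg.1 hts with h' | h'
    · exact Or.inl (by linarith)
    · exact Or.inr (Or.inl (by linarith))
  exact Or.inr (Or.inr (h.isKahler_of_gauduchonHSC_eq hts hHSC))
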